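/- Let $(E,\rho)$ be a metric space in which every closed ball is compact, and let $(X(t))_{t\ge 0}$ be a standard Markov process with state space $E$ and infinite lifetime, with laws $(\mathbb P^x)_{x\in E}$ and expectations $\mathbb E^x$ (i.e. $X(0)=x$ $\mathbb P^x$-a.s., $X$ is strong Markov with respect to a complete and right-continuous filtration, has càdlàg paths in $E$, and is quasi-left-continuous). Assume that $X$ is weakly Feller: for every $t\ge 0$ the operator $P_th(x)=\mathbb E^x\{h(X(t))\}$ maps the space of continuous functions $E\to\mathbb R$ vanishing at infinity into itself. Let $\mathcal O\subseteq E$ be open, $\tau_{\mathcal O}=\inf\{t\ge 0: X(t)\notin\mathcal O\}$ (with $\inf\emptyset=\infty$), and assume (A1) for every $t>0$ the operator $P_t^{\tau_{\mathcal O}}h(x)=\mathbb E^x\{\mathbf 1_{\{t<\tau_{\mathcal O}\}}h(X(t))\}$ maps the space of bounded continuous functions on $E$ into itself. Let $\alpha>0$, let $f,G,H:[0,\infty)\times E\to\mathbb R$ be bounded and continuous, and for $(s,x)\in[0,\infty)\times E$ put $$w(s,x)=\sup_\tau \mathbb E^x\Big\{\int_0^{\tau\wedge\tau_{\mathcal O}}e^{-\alpha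 u}f(s+u,X(u))\,du+\mathbf 1_{\{\tau<\tau_{\mathcal O}\}}e^{-\alpha\tau}G(s+\tau,X(\tau))+\mathbf 1_{\{\tau\ge\tau_{\mathcal O}\}}e^{-\alpha\tau_{\mathcal O}}H(s+\tau_{\mathcal O},X(\tau_{\mathcal O}))\Big\},$$ where the supremum is over all stopping times $\tau$ with values in $[0,\infty]$, and the last term is read as $0$ when $\tau_{\mathcal O}=\infty$. Then for every $s\ge 0$ and every $x\in\partial\mathcal O$, $$\lim_{y\to x,\ y\in\mathcal O}w(s,y)=\max\{G(s,x),H(s,x)\};$$ in particular the limit exists. -/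

import Mathlib

open MeasureTheory Filter Topology
open scoped NNReal ENNReal BoundedContinuousFunction ZeroAtInfty

noncomputable section

/-- A (time-homogeneous, non-terminating) Markov process `(X(t), 𝓕_t, 𝐏^x)` on `E`, with
time set `[0, ∞)`: a process `X` adapted to a filtration `𝓕` and a family of probability laws
`P x`, under which `X` starts at `x` and has the Markov property with respect to `𝓕` with
transition function `(t, x, B) ↦ 𝐏^x {X(t) ∈ B}`. -/
structure MarkovProcess (Ω E : Type*) [mΩ : MeasurableSpace Ω] [MeasurableSpace E] where
  X : ℝ≥0 → Ω → E
  𝓕 : Filtration ℝ≥0 mΩ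
  P : E → Measure Ω
  isProbabilityMeasure : ∀ x, IsProbabilityMeasure (P x)
  adapted : ∀ t, Measurable[𝓕 t] (X t)
  start : ∀ x, ∀ᵐ ω ∂(P x), X 0 ω = x
  measurable_transition : ∀ (t : ℝ≥0) (B : Set E), MeasurableSet B →
    Measurable fun x => P x {ω | X t ω ∈ B}
  /-- `𝐏^x (A ∩ {X(s+t) ∈ B}) = 𝐄^x {1_A 𝐏^{X(s)} {X(t) ∈ B}}` for `A ∈ 𝓕_s`. -/
  markov : ∀ (x : E) (s t : ℝ≥0) (A : Set Ω) (B : Set E), MeasurableSet[𝓕 s] A →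
    MeasurableSet B →
      P x (A ∩ {ω | X (s + t) ω ∈ B}) = ∫⁻ ω in A, P (X s ω) {ω' | X t ω' ∈ B} ∂(P x)

namespace MarkovProcess

section

variable {Ω E : Type*} [mΩ : MeasurableSpace Ω] [MeasurableSpace E]

/-- The position `X(τ)` at a random time `τ` (of interest only on `{τ < ∞}`). -/
def at_ (M : MarkovProcess Ω E) (τ : Ω → WithTop ℝ≥0) (ω : Ω) : E :=
  M.X ((τ ω).untopD 0) ω

/-- A set `N` is negligible for the law `𝐏^μ = ∫ 𝐏^x μ(dx)` if it is covered by an event that has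
`𝐏^x`-probability zero for `μ`-almost every `x`. -/
def Negligible (M : MarkovProcess Ω E) (μ : Measure E) (N : Set Ω) : Prop :=
  ∃ N' : Set Ω, MeasurableSet N' ∧ N ⊆ N' ∧ ∀ᵐ x ∂μ, M.P x N' = 0

/-- Completeness of the filtration of a Markov process: each `𝓕_t` contains every set which, for
every initial law `μ` on `E`, differs from some member of `𝓕_t` by a `𝐏^μ`-negligible set. -/
def IsComplete (M : MarkovProcess Ω E) : Prop :=
  ∀ (t : ℝ≥0) (A : Set Ω),
    (∀ μ : Measure E, IsProbabilityMeasure μ →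
      ∃ B : Set Ω, MeasurableSet[M.𝓕 t] B ∧ M.Negligible μ (symmDiff A B)) →
    MeasurableSet[M.𝓕 t] A

/-- The strong Markov property:
`𝐏^x (A ∩ {τ < ∞} ∩ {X(τ+t) ∈ B}) = 𝐄^x {1_{A ∩ {τ < ∞}} 𝐏^{X(τ)} {X(t) ∈ B}}`
for every stopping time `τ` and `A ∈ 𝓕_τ`. -/
def IsStrongMarkov (M : MarkovProcess Ω E) : Prop :=
  ∀ (x : E) (τ : Ω → WithTop ℝ≥0) (hτ : IsStoppingTime M.𝓕 τ) (t : ℝ≥0) (A : Set Ω) (B : Set E),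
    MeasurableSet[hτ.measurableSpace] A → MeasurableSet B →
      M.P x (A ∩ {ω | τ ω < ⊤} ∩ {ω | M.at_ (fun ω => τ ω + (t : WithTop ℝ≥0)) ω ∈ B}) =
        ∫⁻ ω in A ∩ {ω | τ ω < ⊤}, M.P (M.at_ τ ω) {ω' | M.X t ω' ∈ B} ∂(M.P x)

end

section

variable {Ω E : Type*} [mΩ : MeasurableSpace Ω] [MeasurableSpace E] [TopologicalSpace E]

/-- All paths are right-continuous and have left limits. -/
def IsCadlag (M : MarkovProcess Ω E) : Prop :=
  ∀ ω, (∀ t, ContinuousWithinAt (fun u => M.X u ω) (Set.Ici t) t) ∧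
    ∀ t, 0 < t → ∃ l : E, Tendsto (fun u => M.X u ω) (𝓝[<] t) (𝓝 l)

/-- Quasi-left-continuity: if stopping times `σ n` increase to `σ`, then `X(σ n) → X(σ)`
almost surely on `{σ < ∞}`. -/
def IsQuasiLeftContinuous (M : MarkovProcess Ω E) : Prop :=
  ∀ (σ : ℕ → Ω → WithTop ℝ≥0), (∀ n, IsStoppingTime M.𝓕 (σ n)) → Monotone σ →
    ∀ x, ∀ᵐ ω ∂(M.P x), (⨆ n, σ n ω) < ⊤ →
      Tendsto (fun n => M.at_ (σ n) ω) atTop (𝓝 (M.at_ (fun ω => ⨆ n, σ n ω) ω))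

/-- A standard Markov process. -/
structure IsStandard (M : MarkovProcess Ω E) : Prop where
  strongMarkov : M.IsStrongMarkov
  cadlag : M.IsCadlag
  quasiLeftContinuous : M.IsQuasiLeftContinuous
  complete : M.IsComplete
  rightContinuous : M.𝓕.IsRightContinuous

/-- The weak Feller property: `P_t C₀ ⊆ C₀` for all `t`, with `P_t h(x) = 𝐄^x {h(X(t))}`. -/
def IsWeakFeller (M : MarkovProcess Ω E) : Prop :=
  ∀ (t : ℝ≥0) (h : C₀(E, ℝ)), ∃ g : C₀(E, ℝ), ∀ x, g x = ∫ ω, h (M.X t ω) ∂(M.P x)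

/-- The first exit time `τ_O = inf {t ≥ 0 : X(t) ∉ O}`, equal to `⊤` if there is no such `t`. -/
def exitTime (M : MarkovProcess Ω E) (O : Set E) : Ω → WithTop ℝ≥0 :=
  hittingAfter M.X Oᶜ 0

open scoped Classical in
/-- The stopped semigroup `P_t^{τ_O} h(x) = 𝐄^x {1_{t < τ_O} h(X(t))}`. -/
def stoppedSemigroup (M : MarkovProcess Ω E) (O : Set E) (t : ℝ≥0) (h : E → ℝ) (x : E) : ℝ :=
  ∫ ω, (if (t : WithTop ℝ≥0) < M.exitTime O ω then h (M.X t ω) else 0) ∂(M.P x)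

/-- For every `t > 0` the operator `P_t^{τ_O}` maps the space of bounded continuous functions into
itself. -/
def StoppedFeller (M : MarkovProcess Ω E) (O : Set E) : Prop :=
  ∀ t : ℝ≥0, 0 < t → ∀ h : E →ᵇ ℝ, ∃ g : E →ᵇ ℝ, ∀ x, g x = M.stoppedSemigroup O t h x

/-- The discounted payoff `e^{-α σ} φ(s + σ, X(σ))` collected at a random time `σ`; it is `0` on
`{σ = ∞}`. -/
def discountedPayoff (M : MarkovProcess Ω E) (α : ℝ) (φ : ℝ≥0 × E → ℝ) (s : ℝ≥0)
    (σ : Ω → WithTop ℝ≥0) (ω : Ω) : ℝ :=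
  if σ ω = ⊤ then 0
  else Real.exp (-α * ((σ ω).untopD 0 : ℝ≥0)) * φ (s + (σ ω).untopD 0, M.at_ σ ω)

open scoped Classical in
/-- The functional
`J(s,x,τ) = 𝐄^x {∫_0^{τ ∧ τ_O} e^{-α u} f(s+u, X(u)) du
  + 1_{τ < τ_O} e^{-α τ} G(s+τ, X(τ)) + 1_{τ ≥ τ_O} e^{-α τ_O} H(s+τ_O, X(τ_O))}`. -/
def J (M : MarkovProcess Ω E) (O : Set E) (α : ℝ) (f G H : ℝ≥0 × E → ℝ) (s : ℝ≥0) (x : E)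
    (τ : Ω → WithTop ℝ≥0) : ℝ :=
  ∫ ω, ((∫ u in {u : ℝ | 0 ≤ u ∧ (u.toNNReal : WithTop ℝ≥0) < min (τ ω) (M.exitTime O ω)},
        Real.exp (-α * u) * f (s + u.toNNReal, M.X u.toNNReal ω))
      + (if τ ω < M.exitTime O ω then M.discountedPayoff α G s τ ω
        else M.discountedPayoff α H s (M.exitTime O) ω)) ∂(M.P x)

/-- The value function `w(s,x) = sup_τ J(s,x,τ)`, the supremum being over all stopping times. (For
`α > 0` and bounded `f, G, H` the values of `J` are bounded, so this is a genuine supremum.) -/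
def value (M : MarkovProcess Ω E) (O : Set E) (α : ℝ) (f G H : ℝ≥0 × E → ℝ) (s : ℝ≥0) (x : E) :
    ℝ :=
  ⨆ τ : {τ : Ω → WithTop ℝ≥0 // IsStoppingTime M.𝓕 τ}, M.J O α f G H s x τ

end

end MarkovProcess

end

/-!
Let `x` be a boundary point of `O`. Since `O` is open, `x ∉ O`, so a process started at `x` exits
at time `0` and `P_t^{τ_O} 1 (x) = 0`. Continuity of `P_t^{τ_O} 1` then shows that `τ_O` is small
with high probability for starting points `y` near `x`. If moreover `X(τ ∧ τ_O)` is near `x` with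
high probability, uniformly in the stopping time `τ`, then the running payoff is negligible and the
payoff is close to `G (s, x)` if `τ < τ_O` and to `H (s, x)` otherwise. This gives the upper bound;
the lower bounds come from `τ = 0` (as `τ_O > 0` when starting in `O`) and `τ = ∞`.

The remaining point is that for stopping times `ρ y ≤ 1` with `𝐄^y {ρ y} → 0` as `y → x`, the law
`ν y` of `X(ρ y)` under `𝐏^y` converges to the Dirac mass at `x` (`tendsto_measure_dist_ge`). For
`h` vanishing at infinity, the time average `A_b h = ∫_0^1 P_{bu} h du` again vanishes at infinity,
and the strong Markov property gives
`|𝐄^y {A_b h (X(ρ y))} - A_b h (y)| ≤ (2 ‖h‖ / b) 𝐄^y {ρ y}`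
(`abs_integral_semigroupAverage_sub_le`), so that `∫ A_b h dν y → A_b h (x)` for every `b > 0`. As
`b → 0`, `A_b h → h` boundedly and pointwise; by compactness of the space of probability measures
on the one-point compactification this is enough to conclude `∫ h dν y → h x`
(`tendsto_integral_of_bounded_pointwise_limit`).

Measurability requires the exit time to agree almost surely with a stopping time, which follows
from quasi-left-continuity (`exists_isStoppingTime_ae_eq_exitTime`).
-/

/-! ### Exit times of open sets -/

namespace MarkovProcess

section ExitTime

variable {Ω E : Type*} [MeasurableSpace Ω] [MetricSpace E] [MeasurableSpace E]

theorem isStoppingTime_hittingAfter_of_isOpen [BorelSpace E] (M : MarkovProcess Ω E) (hc : M.IsCadlag)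
    (hr : M.𝓕.IsRightContinuous) {U : Set E} (hU : IsOpen U) :
    IsStoppingTime M.𝓕 (hittingAfter M.X U 0) := by
  apply isStoppingTime_of_measurableSet_lt_of_isRightContinuous
  intro i
  obtain ⟨D, hDc, hDd⟩ := TopologicalSpace.exists_countable_dense ℝ≥0
  have : {ω | hittingAfter M.X U 0 ω < i} = ⋃ q ∈ D ∩ Set.Iio i, M.X q ⁻¹' U := by
    ext ω
    simp only [Set.mem_ofPred_eq, Set.mem_iUnion, Set.mem_preimage, exists_prop]
    constructor
    · intro h
      -- right-continuity moves a hit of the open set to a nearby later time in `D`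
      obtain ⟨t, hti, htU⟩ : ∃ t < i, M.X t ω ∈ U := by
        by_contra! hcon
        have hne : ∃ j, 0 ≤ j ∧ M.X j ω ∈ U := by
          by_contra! h'
          rw [hittingAfter_eq_top_iff.2 h'] at h
          exact not_top_lt h
        rw [hittingAfter, if_pos hne, WithTop.coe_lt_coe] at h
        obtain ⟨t, ht, hti⟩ := exists_lt_of_csInf_lt hne h
        exact hcon t hti ht.2
      have h1 : ∀ᶠ u in 𝓝[>] t, M.X u ω ∈ U :=
        (((hc ω).1 t).mono Set.Ioi_subset_Ici_self).eventually (hU.mem_nhds htU)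
      obtain ⟨b, hb, hbU⟩ := (mem_nhdsGT_iff_exists_Ioo_subset' hti).1 h1
      obtain ⟨q, hqD, hq⟩ := hDd.exists_between (lt_min hb hti)
      exact ⟨q, ⟨hqD, hq.2.trans_le (min_le_right _ _)⟩,
        hbU ⟨hq.1, hq.2.trans_le (min_le_left _ _)⟩⟩
    · rintro ⟨q, ⟨-, hq⟩, hqU⟩
      exact (hittingAfter_le_of_mem zero_le hqU).trans_lt (WithTop.coe_lt_coe.2 hq)
  rw [this]
  refine MeasurableSet.biUnion (hDc.mono Set.inter_subset_left) fun q hq => ?_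
  exact M.𝓕.mono (le_of_lt hq.2) _ (M.adapted q hU.measurableSet)

/-- By right-continuity, at the hitting time of `U` the process is in the closure of `U`. -/
theorem at_hittingAfter_mem_closure (M : MarkovProcess Ω E) (hc : M.IsCadlag) (U : Set E) {ω : Ω}
    (h : hittingAfter M.X U 0 ω < ⊤) : M.at_ (hittingAfter M.X U 0) ω ∈ closure U := by
  have hne : ∃ j, 0 ≤ j ∧ M.X j ω ∈ U := by
    by_contra! h'
    exact h.ne (hittingAfter_eq_top_iff.2 h')
  rw [at_, hittingAfter, if_pos hne, WithTop.untopD_coe]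
  have h1 : sInf {i : ℝ≥0 | 0 ≤ i ∧ M.X i ω ∈ U} ∈ closure {i : ℝ≥0 | 0 ≤ i ∧ M.X i ω ∈ U} :=
    csInf_mem_closure hne (OrderBot.bddBelow _)
  refine closure_mono ?_ ((((hc ω).1 _).mono fun i hi => ?_).mem_closure_image h1)
  · rintro _ ⟨i, hi, rfl⟩
    exact hi.2
  · exact csInf_le (OrderBot.bddBelow _) hi

/-- The exit time of an open set agrees almost surely with a stopping time: the supremum of the
hitting times of the open neighbourhoods of the complement, at which the process is in the
complement by quasi-left-continuity. -/
theorem exists_isStoppingTime_ae_eq_exitTime [BorelSpace E] (M : MarkovProcess Ω E) (hM : M.IsStandard)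
    {O : Set E} (hO : IsOpen O) :
    ∃ σ : Ω → WithTop ℝ≥0, IsStoppingTime M.𝓕 σ ∧ ∀ y, ∀ᵐ ω ∂(M.P y), M.exitTime O ω = σ ω := by
  have hr := hM.rightContinuous
  set δ : ℕ → ℝ := fun n => 1 / ((n : ℝ) + 1)
  have hδ : ∀ n, 0 < δ n := fun n => Nat.one_div_pos_of_nat
  set S : ℕ → Ω → WithTop ℝ≥0 := fun n => hittingAfter M.X (Metric.thickening (δ n) Oᶜ) 0 with hS
  have hSst : ∀ n, IsStoppingTime M.𝓕 (S n) := fun n =>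
    M.isStoppingTime_hittingAfter_of_isOpen hM.cadlag hr Metric.isOpen_thickening
  have hanti : ∀ {A B : Set E}, A ⊆ B → ∀ ω, hittingAfter M.X B 0 ω ≤ hittingAfter M.X A 0 ω :=
    fun {A B} hAB ω => hittingAfter_anti M.X 0 hAB ω
  have hmono : Monotone S := fun m n hmn ω =>
    hanti (Metric.thickening_mono (one_div_le_one_div_of_le (by positivity) (by gcongr)) _) ω
  refine ⟨fun ω => ⨆ n, S n ω, fun i => ?_, fun y => ?_⟩
  · simp only [iSup_le_iff]
    rw [Set.ofPred_forall]
    exact MeasurableSet.iInter fun n => hSst n i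
  · filter_upwards [hM.quasiLeftContinuous S hSst hmono y] with ω hω
    refine le_antisymm ?_ (iSup_le fun n => hanti (Metric.self_subset_thickening (hδ n) _) ω)
    rcases eq_or_ne (⨆ n, S n ω) ⊤ with htop | htop
    · simp [htop]
    have hlim := hω htop.lt_top
    have hmem : M.at_ (fun ω => ⨆ n, S n ω) ω ∈ Oᶜ := by
      rw [← hO.isClosed_compl.closure_eq, Metric.closure_eq_iInter_cthickening]
      refine Set.mem_iInter₂.2 fun ε hε => ?_
      refine Metric.isClosed_cthickening.mem_of_tendsto hlim ?_
      have hδlim : Tendsto δ atTop (𝓝 0) := tendsto_one_div_add_atTop_nhds_zero_nat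
      filter_upwards [hδlim.eventually (gt_mem_nhds hε)] with n hn
      have hfin : S n ω < ⊤ := (le_iSup (fun n => S n ω) n).trans_lt htop.lt_top
      exact (Metric.closure_thickening_subset_cthickening _ _).trans
        (Metric.cthickening_mono hn.le _) (M.at_hittingAfter_mem_closure hM.cadlag _ hfin)
    -- the limit point lies in the complement of `O`, so the exit has occurred by the supremum
    lift (⨆ n, S n ω) to ℝ≥0 using htop with t ht
    refine hittingAfter_le_of_mem zero_le ?_
    rwa [at_, ← ht] at hmem

end ExitTime

end MarkovProcess

/-! ### Weak convergence and bounded pointwise limits -/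

section WeakConvergence

variable {E : Type*} [TopologicalSpace E] [T2Space E]

/-- The extension of a function vanishing at infinity to the one-point compactification. -/
def ZeroAtInftyContinuousMap.toOnePoint (g : C₀(E, ℝ)) : C(OnePoint E, ℝ) where
  toFun p := p.elim 0 g
  continuous_toFun := by
    refine continuous_iff_continuousAt.2 fun p => ?_
    induction p using OnePoint.rec with
    | infty =>
      refine OnePoint.continuousAt_infty'.2 ?_
      rw [coclosedCompact_eq_cocompact]
      exact zero_at_infty g
    | coe z => exact OnePoint.continuousAt_coe.2 g.continuous.continuousAt

/-- A family of laws which converges to the Dirac mass at `x` when tested on functions `g n`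
vanishing at infinity, also does so when tested on a bounded pointwise limit of the `g n`. This
holds since the laws are relatively compact on the one-point compactification, and integration
against a limit law respects bounded pointwise convergence. -/
theorem tendsto_integral_of_bounded_pointwise_limit [LocallyCompactSpace E]
    [MeasurableSpace E] [BorelSpace E] {ι : Type*} {l : Filter ι} (ν : ι → ProbabilityMeasure E)
    (g : ℕ → C₀(E, ℝ)) (h : C₀(E, ℝ)) {C : ℝ} (hC : ∀ n z, |g n z| ≤ C)
    (hlim : ∀ z, Tendsto (fun n => g n z) atTop (𝓝 (h z))) (x : E)
    (hν : ∀ n, Tendsto (fun i => ∫ z, g n z ∂(ν i : Measure E)) l (𝓝 (g n x))) :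
    Tendsto (fun i => ∫ z, h z ∂(ν i : Measure E)) l (𝓝 (h x)) := by
  let : MeasurableSpace (OnePoint E) := borel _
  have : BorelSpace (OnePoint E) := ⟨rfl⟩
  have hcoe : Measurable ((↑) : E → OnePoint E) := OnePoint.continuous_coe.measurable
  set ν' : ι → ProbabilityMeasure (OnePoint E) := fun i => (ν i).map hcoe.aemeasurable
  have hint : ∀ (k : C₀(E, ℝ)) i, ∫ p, k.toOnePoint p ∂(ν' i : Measure (OnePoint E)) =
      ∫ z, k z ∂(ν i : Measure E) := fun k i =>
    integral_map hcoe.aemeasurable k.toOnePoint.continuous.aestronglyMeasurable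
  refine tendsto_iff_ultrafilter _ _ _ |>.2 fun U hU => ?_
  obtain ⟨μ, -, hμ⟩ := isCompact_univ.ultrafilter_le_nhds (U.map ν') (by simp)
  have hconv : ∀ k : C₀(E, ℝ), Tendsto (fun i => ∫ z, k z ∂(ν i : Measure E)) U
      (𝓝 (∫ p, k.toOnePoint p ∂(μ : Measure (OnePoint E)))) := fun k => by
    have := (ProbabilityMeasure.tendsto_iff_forall_integral_tendsto.1
      (show Tendsto ν' U (𝓝 μ) from hμ)) (BoundedContinuousFunction.mkOfCompact k.toOnePoint)
    simpa only [BoundedContinuousFunction.mkOfCompact_apply, hint] using this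
  have hval : ∀ n, ∫ p, (g n).toOnePoint p ∂(μ : Measure (OnePoint E)) = g n x := fun n =>
    tendsto_nhds_unique (hconv (g n)) ((hν n).mono_left hU)
  have hdom : Tendsto (fun n => ∫ p, (g n).toOnePoint p ∂(μ : Measure (OnePoint E))) atTop
      (𝓝 (∫ p, h.toOnePoint p ∂(μ : Measure (OnePoint E)))) := by
    refine tendsto_integral_of_dominated_convergence (fun _ => C)
      (fun n => (g n).toOnePoint.continuous.aestronglyMeasurable) (integrable_const C)
      (fun n => .of_forall fun p => ?_) (.of_forall fun p => ?_)
    · induction p using OnePoint.rec with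
      | infty => simpa [ZeroAtInftyContinuousMap.toOnePoint] using (abs_nonneg _).trans (hC 0 x)
      | coe z => exact hC n z
    · induction p using OnePoint.rec with
      | infty => exact tendsto_const_nhds
      | coe z => exact hlim z
  simp only [hval] at hdom
  exact tendsto_nhds_unique hdom (hlim x) ▸ hconv h

end WeakConvergence

/-! ### Joint measurability, the semigroup and its time averages -/

section RightContinuous

variable {α β : Type*} [MeasurableSpace α] [TopologicalSpace β]
  [TopologicalSpace.PseudoMetrizableSpace β] [MeasurableSpace β] [BorelSpace β]

/-- A family of measurable functions depending right-continuously on time is jointly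
measurable. -/
theorem measurable_uncurry_of_rightContinuous {F : ℝ≥0 → α → β} (hF : ∀ t, Measurable (F t))
    (hc : ∀ a t, ContinuousWithinAt (fun u => F u a) (Set.Ici t) t) :
    Measurable fun p : ℝ≥0 × α => F p.1 p.2 := by
  -- the next point after `t` on the grid of mesh `1 / (n + 1)`
  set d : ℕ → ℝ≥0 → ℝ≥0 := fun n t => ((⌊(n + 1 : ℝ≥0) * t⌋₊ + 1 : ℕ) : ℝ≥0) / (n + 1)
  have hd : ∀ n t, t ≤ d n t := fun n t => by
    rw [le_div_iff₀ (by positivity), mul_comm]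
    exact_mod_cast (Nat.lt_floor_add_one ((n + 1 : ℝ≥0) * t)).le
  have hd' : ∀ n t, d n t ≤ t + 1 / (n + 1) := fun n t => by
    rw [div_le_iff₀ (by positivity), add_mul t, div_mul_cancel₀ _ (by positivity), mul_comm t]
    push_cast
    gcongr
    exact Nat.floor_le zero_le
  refine measurable_of_tendsto_metrizable (f := fun n (p : ℝ≥0 × α) => F (d n p.1) p.2)
    (fun n => ?_) (tendsto_pi_nhds.2 fun p => ?_)
  · have h1 : Measurable fun q : ℕ × α => F (((q.1 + 1 : ℕ) : ℝ≥0) / (n + 1)) q.2 :=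
      measurable_from_prod_countable_right fun k => hF (((k + 1 : ℕ) : ℝ≥0) / (n + 1))
    have h2 : Measurable fun p : ℝ≥0 × α => (⌊(n + 1 : ℝ≥0) * p.1⌋₊, p.2) :=
      (Nat.measurable_floor.comp (measurable_fst.const_mul _)).prodMk measurable_snd
    exact h1.comp h2
  · refine (hc p.2 p.1).tendsto.comp (tendsto_nhdsWithin_iff.2 ⟨?_, .of_forall fun n => hd n _⟩)
    refine tendsto_of_tendsto_of_tendsto_of_le_of_le tendsto_const_nhds ?_
      (fun n => hd n p.1) (fun n => hd' n p.1)
    simpa using tendsto_const_nhds.add (tendsto_one_div_add_atTop_nhds_zero_nat (𝕜 := ℝ≥0))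

end RightContinuous

/-- The windows `[r, r + b]` and `[0, b]` differ by two intervals of length `r`. -/
theorem abs_setIntegral_shift_sub_le {k : ℝ → ℝ} {C : ℝ} (hk : Measurable k) (hC : ∀ u, |k u| ≤ C)
    {b r : ℝ} (hb : 0 < b) (hr : 0 ≤ r) :
    |(∫ u in Set.Ioc (0 : ℝ) 1, k (r + b * u)) - ∫ u in Set.Ioc (0 : ℝ) 1, k (b * u)| ≤
      2 * C / b * r := by
  have hint : ∀ a c, IntervalIntegrable k volume a c := fun a c =>
    (intervalIntegrable_const (c := C)).mono_fun hk.aestronglyMeasurable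
      (.of_forall fun u => (hC u).trans (le_abs_self C))
  have hbd : ∀ a c, |∫ u in a..c, k u| ≤ C * |c - a| := fun a c =>
    intervalIntegral.norm_integral_le_of_norm_le_const (f := k) fun u _ => hC u
  rw [← intervalIntegral.integral_of_le zero_le_one, ← intervalIntegral.integral_of_le zero_le_one,
    intervalIntegral.integral_comp_add_mul _ hb.ne',
    intervalIntegral.integral_comp_mul_left _ hb.ne', ← smul_sub,
    intervalIntegral.integral_interval_sub_interval_comm (hint _ _) (hint _ _) (hint _ _),
    smul_eq_mul, abs_mul, abs_of_pos (inv_pos.2 hb), mul_zero, mul_one, add_zero]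
  have h1 := hbd r 0
  have h2 := hbd (r + b) b
  rw [show (0 : ℝ) - r = -r by ring, abs_neg, abs_of_nonneg hr] at h1
  rw [show b - (r + b) = -r by ring, abs_neg, abs_of_nonneg hr] at h2
  calc b⁻¹ * _ ≤ b⁻¹ * (C * r + C * r) := by
        gcongr
        exact (abs_sub _ _).trans (add_le_add h1 h2)
    _ = _ := by ring

namespace MarkovProcess

section Semigroup

variable {Ω E : Type*} [MeasurableSpace Ω] [MeasurableSpace E]

/-- The transition semigroup `P_t h(z) = 𝐄^z {h(X(t))}`. -/
noncomputable def semigroup (M : MarkovProcess Ω E) (t : ℝ≥0) (h : E → ℝ) (z : E) : ℝ :=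
  ∫ ω, h (M.X t ω) ∂(M.P z)

/-- The time average `∫_0^1 P_{b u} h(z) du` of the semigroup over the interval `[0, b]`. -/
noncomputable def semigroupAverage (M : MarkovProcess Ω E) (b : ℝ≥0) (h : E → ℝ) (z : E) : ℝ :=
  ∫ u in Set.Ioc (0 : ℝ) 1, M.semigroup (b * u.toNNReal) h z

theorem measurable_X {M : MarkovProcess Ω E} (t : ℝ≥0) : Measurable (M.X t) :=
  (M.adapted t).mono (M.𝓕.le t) le_rfl

variable [MetricSpace E] {M : MarkovProcess Ω E} {h : C₀(E, ℝ)} {C : ℝ}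

theorem abs_semigroup_le (hC : ∀ z, |h z| ≤ C) (t : ℝ≥0) (z : E) : |M.semigroup t h z| ≤ C := by
  have := M.isProbabilityMeasure z
  simpa [semigroup] using norm_integral_le_of_norm_le_const (μ := M.P z) (f := fun ω => h (M.X t ω))
    (.of_forall fun ω => hC _)

theorem semigroup_zero (h : C₀(E, ℝ)) (z : E) : M.semigroup 0 h z = h z := by
  have := M.isProbabilityMeasure z
  rw [semigroup, integral_congr_ae (g := fun _ => h z)
    ((M.start z).mono fun ω hω => by simp only [hω])]
  simp

theorem abs_semigroupAverage_le (hC : ∀ z, |h z| ≤ C) (b : ℝ≥0) (z : E) :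
    |M.semigroupAverage b h z| ≤ C := by
  have := norm_setIntegral_le_of_norm_le_const (μ := volume) (s := Set.Ioc (0 : ℝ) 1)
    (f := fun u => M.semigroup (b * u.toNNReal) h z) (by simp)
    (fun u _ => abs_semigroup_le hC _ z)
  simpa [semigroupAverage] using this

variable [BorelSpace E]

theorem measurable_uncurry_X (hc : M.IsCadlag) :
    Measurable fun p : ℝ≥0 × Ω => M.X p.1 p.2 :=
  measurable_uncurry_of_rightContinuous measurable_X fun ω => (hc ω).1

theorem measurable_at (hc : M.IsCadlag) {τ : Ω → WithTop ℝ≥0} (hτ : Measurable τ) :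
    Measurable (M.at_ τ) :=
  (measurable_uncurry_X hc).comp ((hτ.untopD 0).prodMk measurable_id)

theorem semigroup_rightContinuous (hc : M.IsCadlag) (hC : ∀ z, |h z| ≤ C) (z : E) (t : ℝ≥0) :
    ContinuousWithinAt (fun u => M.semigroup u h z) (Set.Ici t) t := by
  have := M.isProbabilityMeasure z
  refine tendsto_integral_filter_of_dominated_convergence (fun _ => C)
    (.of_forall fun u => (h.continuous.measurable.comp (measurable_X u)).aestronglyMeasurable)
    (.of_forall fun u => .of_forall fun ω => hC _) (integrable_const C) (.of_forall fun ω => ?_)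
  exact h.continuous.continuousAt.tendsto.comp ((hc ω).1 t)

theorem measurable_uncurry_semigroup (hc : M.IsCadlag) (hF : M.IsWeakFeller)
    (hC : ∀ z, |h z| ≤ C) : Measurable fun p : ℝ≥0 × E => M.semigroup p.1 h p.2 := by
  refine measurable_uncurry_of_rightContinuous (fun t => ?_)
    (semigroup_rightContinuous hc hC)
  obtain ⟨g, hg⟩ := hF t h
  rw [show M.semigroup t h = g from funext fun z => (hg z).symm]
  exact g.continuous.measurable

/-- The strong Markov property, integrated against a function vanishing at infinity. -/
theorem integral_comp_X_add (hM : M.IsStandard) (hC : ∀ z, |h z| ≤ C) {ρ : Ω → ℝ≥0}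
    (hρ : IsStoppingTime M.𝓕 fun ω => (ρ ω : WithTop ℝ≥0)) (t : ℝ≥0) (y : E) :
    ∫ ω, h (M.X (ρ ω + t) ω) ∂(M.P y) = ∫ ω, M.semigroup t h (M.X (ρ ω) ω) ∂(M.P y) := by
  have := M.isProbabilityMeasure
  have hρm : Measurable ρ := hρ.measurable'.untopD 0
  have hX : Measurable fun ω => M.X (ρ ω) ω :=
    (measurable_uncurry_X hM.cadlag).comp (hρm.prodMk measurable_id)
  have hXt : Measurable fun ω => M.X (ρ ω + t) ω :=
    (measurable_uncurry_X hM.cadlag).comp ((hρm.add_const t).prodMk measurable_id)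
  let κ : ProbabilityTheory.Kernel E E :=
    ⟨fun z => (M.P z).map (M.X t), Measure.measurable_of_measurable_coe _ fun B hB => by
      simp only [Measure.map_apply (measurable_X t) hB]
      exact M.measurable_transition t B hB⟩
  have hκ : ∀ z, κ z = (M.P z).map (M.X t) := fun z => rfl
  have hmarkov : (M.P y).map (fun ω => M.X (ρ ω + t) ω) =
      ((M.P y).map fun ω => M.X (ρ ω) ω).bind κ := by
    ext B hB
    rw [Measure.bind_apply hB κ.aemeasurable, lintegral_map (κ.measurable_coe hB) hX,
      Measure.map_apply hXt hB]
    have := hM.strongMarkov y _ hρ t Set.univ B MeasurableSet.univ hB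
    simp only [WithTop.coe_lt_top, at_, Set.ofPred_true, Set.univ_inter, ← WithTop.coe_add,
      WithTop.untopD_coe, Measure.restrict_univ] at this
    simp only [hκ, Measure.map_apply (measurable_X t) hB]
    exact this
  have hh : StronglyMeasurable h := h.continuous.stronglyMeasurable
  rw [← integral_map (f := h) hXt.aemeasurable hh.aestronglyMeasurable, hmarkov,
    Measure.comp_eq_comp_const_apply, ProbabilityTheory.Kernel.integral_comp,
    ProbabilityTheory.Kernel.const_apply]
  · rw [integral_map hX.aemeasurable]
    · refine integral_congr_ae (.of_forall fun ω => ?_)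
      simp only [hκ, semigroup]
      exact integral_map (measurable_X t).aemeasurable hh.aestronglyMeasurable
    · exact hh.integral_kernel.aestronglyMeasurable
  · rw [← Measure.comp_eq_comp_const_apply, ← hmarkov]
    have : IsProbabilityMeasure ((M.P y).map (fun ω => M.X (ρ ω + t) ω)) :=
      Measure.isProbabilityMeasure_map hXt.aemeasurable
    exact .of_bound hh.aestronglyMeasurable C (.of_forall hC)

theorem exists_zeroAtInfty_eq_semigroupAverage [ProperSpace E] (hc : M.IsCadlag)
    (hF : M.IsWeakFeller) (hC : ∀ z, |h z| ≤ C) (b : ℝ≥0) :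
    ∃ g : C₀(E, ℝ), ∀ z, g z = M.semigroupAverage b h z := by
  have hmeas : ∀ z, AEStronglyMeasurable (fun u : ℝ => M.semigroup (b * u.toNNReal) h z)
      (volume.restrict (Set.Ioc (0 : ℝ) 1)) := fun z =>
    ((measurable_uncurry_semigroup hc hF hC).comp
      ((measurable_real_toNNReal.const_mul b).prodMk measurable_const)).aestronglyMeasurable
  choose g hg using fun t => hF t h
  have hg' : ∀ t, M.semigroup t h = g t := fun t => funext fun z => (hg t z).symm
  have : (cocompact E).IsCountablyGenerated := by
    rcases isEmpty_or_nonempty E with hE | ⟨⟨z₀⟩⟩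
    · rw [show cocompact E = ⊥ from Subsingleton.elim _ _]
      infer_instance
    · rw [← comap_dist_left_atTop_eq_cocompact z₀]
      infer_instance
  refine ⟨⟨⟨M.semigroupAverage b h, ?_⟩, ?_⟩, fun z => rfl⟩
  · refine continuous_of_dominated (bound := fun _ => C) hmeas
      (fun z => .of_forall fun u => abs_semigroup_le hC _ z) (integrable_const C)
      (.of_forall fun u => ?_)
    rw [hg']
    exact (g _).continuous
  · have hz : (∫ u in Set.Ioc (0 : ℝ) 1, (0 : ℝ)) = 0 := by simp
    have hlim : Tendsto (fun z => M.semigroupAverage b h z) (cocompact E)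
        (𝓝 (∫ u in Set.Ioc (0 : ℝ) 1, (0 : ℝ))) := by
      refine tendsto_integral_filter_of_dominated_convergence (fun _ => C)
        (.of_forall hmeas) (.of_forall fun z => .of_forall fun u => abs_semigroup_le hC _ z)
        (integrable_const C) (.of_forall fun u => ?_)
      rw [hg']
      exact zero_at_infty (g _)
    rwa [hz] at hlim

theorem tendsto_semigroupAverage (hc : M.IsCadlag) (hF : M.IsWeakFeller) (hC : ∀ z, |h z| ≤ C)
    (z : E) {b : ℕ → ℝ≥0} (hb : Tendsto b atTop (𝓝 0)) :
    Tendsto (fun n => M.semigroupAverage (b n) h z) atTop (𝓝 (h z)) := by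
  rw [show h z = ∫ u in Set.Ioc (0 : ℝ) 1, h z by simp]
  refine tendsto_integral_of_dominated_convergence (fun _ => C) (fun n => ?_)
    (integrable_const C) (fun n => .of_forall fun u => abs_semigroup_le hC _ z)
    (.of_forall fun u => ?_)
  · exact ((measurable_uncurry_semigroup hc hF hC).comp
      ((measurable_real_toNNReal.const_mul (b n)).prodMk measurable_const)).aestronglyMeasurable
  · have h1 : Tendsto (fun n => b n * u.toNNReal) atTop (𝓝[≥] 0) :=
      tendsto_nhdsWithin_iff.2 ⟨by simpa using hb.mul_const u.toNNReal,
        .of_forall fun _ => Set.mem_Ici.2 zero_le⟩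
    simpa only [semigroup_zero, Function.comp_def] using
      (semigroup_rightContinuous hc hC z 0).tendsto.comp h1

/-- Shifting the starting time by a small stopping time hardly changes a time average of the
semigroup. -/
theorem abs_integral_semigroupAverage_sub_le (hM : M.IsStandard) (hF : M.IsWeakFeller)
    (hC : ∀ z, |h z| ≤ C) {ρ : Ω → ℝ≥0} (hρ : IsStoppingTime M.𝓕 fun ω => (ρ ω : WithTop ℝ≥0))
    (hρ1 : ∀ ω, ρ ω ≤ 1) {b : ℝ≥0} (hb : 0 < b) (y : E) :
    |∫ ω, M.semigroupAverage b h (M.X (ρ ω) ω) ∂(M.P y) - M.semigroupAverage b h y| ≤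
      2 * C / b * ∫ ω, (ρ ω : ℝ) ∂(M.P y) := by
  have := M.isProbabilityMeasure y
  have hc := hM.cadlag
  have hρm : Measurable ρ := hρ.measurable'.untopD 0
  have hX := measurable_uncurry_X hc
  set V : Measure ℝ := volume.restrict (Set.Ioc (0 : ℝ) 1) with hV
  have htime : Measurable fun p : ℝ × Ω => b * p.1.toNNReal :=
    (measurable_real_toNNReal.comp measurable_fst).const_mul b
  have hρm2 : Measurable fun p : ℝ × Ω => ρ p.2 := hρm.comp measurable_snd
  have hm1 : Measurable fun p : ℝ × Ω => M.semigroup (b * p.1.toNNReal) h (M.X (ρ p.2) p.2) :=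
    (measurable_uncurry_semigroup hc hF hC).comp
      (htime.prodMk (hX.comp (hρm2.prodMk measurable_snd)))
  have hm2 : Measurable fun p : ℝ × Ω => h (M.X (ρ p.2 + b * p.1.toNNReal) p.2) :=
    h.continuous.measurable.comp (hX.comp ((hρm2.add htime).prodMk measurable_snd))
  have hm3 : Measurable fun p : ℝ × Ω => h (M.X (b * p.1.toNNReal) p.2) :=
    h.continuous.measurable.comp (hX.comp (htime.prodMk measurable_snd))
  have hi : ∀ {g : ℝ × Ω → ℝ}, Measurable g → (∀ p, |g p| ≤ C) →
      Integrable g (V.prod (M.P y)) := fun hg hgC =>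
    .of_bound hg.aestronglyMeasurable C (.of_forall hgC)
  have e1 : ∫ ω, M.semigroupAverage b h (M.X (ρ ω) ω) ∂(M.P y) =
      ∫ ω, ∫ u, h (M.X (ρ ω + b * u.toNNReal) ω) ∂V ∂(M.P y) := by
    simp only [semigroupAverage, ← hV]
    rw [← integral_integral_swap (μ := V) (ν := M.P y)
        (f := fun u ω => M.semigroup (b * u.toNNReal) h (M.X (ρ ω) ω))
        (hi hm1 fun p => abs_semigroup_le hC _ _),
      ← integral_integral_swap (μ := V) (ν := M.P y)
        (f := fun u ω => h (M.X (ρ ω + b * u.toNNReal) ω)) (hi hm2 fun p => hC _)]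
    exact integral_congr_ae (.of_forall fun u => (integral_comp_X_add hM hC hρ _ y).symm)
  have e2 : M.semigroupAverage b h y = ∫ ω, ∫ u, h (M.X (b * u.toNNReal) ω) ∂V ∂(M.P y) := by
    simp only [semigroupAverage, ← hV, semigroup]
    exact integral_integral_swap (μ := V) (ν := M.P y)
      (f := fun u ω => h (M.X (b * u.toNNReal) ω)) (hi hm3 fun p => hC _)
  rw [e1, e2, ← integral_sub (hi hm2 fun p => hC _).integral_prod_right
    (hi hm3 fun p => hC _).integral_prod_right, ← integral_const_mul, ← Real.norm_eq_abs]
  have hρi : Integrable (fun ω => (ρ ω : ℝ)) (M.P y) :=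
    .of_bound hρm.coe_nnreal_real.aestronglyMeasurable 1
      (.of_forall fun ω => by simpa using hρ1 ω)
  refine norm_integral_le_of_norm_le (hρi.const_mul _) (.of_forall fun ω => ?_)
  have hk : Measurable fun u : ℝ => h (M.X u.toNNReal ω) :=
    h.continuous.measurable.comp (hX.comp (measurable_real_toNNReal.prodMk measurable_const))
  have := abs_setIntegral_shift_sub_le hk (fun u => hC _) (NNReal.coe_pos.2 hb) (ρ ω).coe_nonneg
  rw [Real.norm_eq_abs]
  convert this using 3 <;>
  · refine setIntegral_congr_fun measurableSet_Ioc fun u hu => ?_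
    have hu0 : 0 ≤ u := hu.1.le
    have : (b * u.toNNReal : ℝ≥0) = ((b : ℝ) * u).toNNReal := by
      rw [Real.toNNReal_mul b.coe_nonneg, Real.toNNReal_coe]
    simp only [this, Real.toNNReal_add (ρ ω).coe_nonneg (mul_nonneg b.coe_nonneg hu0),
      Real.toNNReal_coe]

end Semigroup

end MarkovProcess

/-! ### Position at a small stopping time -/

/-- A tent function with peak at `x` and support in the closed ball of radius `r`. -/
theorem exists_zeroAtInfty_tent {E : Type*} [MetricSpace E] [ProperSpace E] (x : E) {r : ℝ}
    (hr : 0 < r) : ∃ h : C₀(E, ℝ), h x = 1 ∧ (∀ z, |h z| ≤ 1) ∧ ∀ z, r ≤ dist z x → h z = 0 := by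
  have hcont : Continuous fun z : E => max 0 (1 - dist z x / r) := by fun_prop
  have hzero : ∀ z, r ≤ dist z x → max 0 (1 - dist z x / r) = 0 := fun z hz =>
    max_eq_left (sub_nonpos.2 ((one_le_div hr).2 hz))
  refine ⟨⟨⟨_, hcont⟩, ?_⟩, ?_, fun z => ?_, hzero⟩
  · refine tendsto_const_nhds.congr' ?_
    filter_upwards [(isCompact_closedBall x r).compl_mem_cocompact] with z hz
    exact (hzero z (not_le.1 fun h => hz h).le).symm
  · change max 0 (1 - dist x x / r) = 1
    simp
  · change |max 0 (1 - dist z x / r)| ≤ 1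
    rw [abs_of_nonneg (le_max_left _ _)]
    exact max_le zero_le_one (sub_le_self _ (by positivity))

namespace MarkovProcess

variable {Ω E : Type*} [MeasurableSpace Ω] [MetricSpace E] [MeasurableSpace E]
  {M : MarkovProcess Ω E}

section Convergence

/-- If the process starts near `x` and the stopping times `ρ y` have small expectation, then the
position at `ρ y` is near `x` with high probability. -/
theorem tendsto_measure_dist_ge [BorelSpace E] [ProperSpace E] (hM : M.IsStandard)
    (hF : M.IsWeakFeller) (x : E)
    (ρ : E → Ω → ℝ≥0) (hρ : ∀ y, IsStoppingTime M.𝓕 fun ω => (ρ y ω : WithTop ℝ≥0))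
    (hρ1 : ∀ y ω, ρ y ω ≤ 1)
    (hlim : Tendsto (fun y => ∫ ω, (ρ y ω : ℝ) ∂(M.P y)) (𝓝 x) (𝓝 0)) {r : ℝ} (hr : 0 < r) :
    Tendsto (fun y => (M.P y).real {ω | r ≤ dist (M.X (ρ y ω) ω) x}) (𝓝 x) (𝓝 0) := by
  have := M.isProbabilityMeasure
  obtain ⟨h, hx, hC, hfar⟩ := exists_zeroAtInfty_tent x hr
  have hX : ∀ y, Measurable fun ω => M.X (ρ y ω) ω := fun y =>
    (measurable_uncurry_X hM.cadlag).comp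
      (((hρ y).measurable'.untopD 0).prodMk measurable_id)
  set b : ℕ → ℝ≥0 := fun n => 1 / ((n : ℝ≥0) + 1)
  have hb : ∀ n, 0 < b n := fun n => by positivity
  choose g hg using fun n => exists_zeroAtInfty_eq_semigroupAverage hM.cadlag hF hC (b n)
  let ν : E → ProbabilityMeasure E := fun y =>
    ⟨(M.P y).map fun ω => M.X (ρ y ω) ω, Measure.isProbabilityMeasure_map (hX y).aemeasurable⟩
  have hν : ∀ (k : C₀(E, ℝ)) y, ∫ z, k z ∂(ν y : Measure E) = ∫ ω, k (M.X (ρ y ω) ω) ∂(M.P y) :=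
    fun k y => integral_map (hX y).aemeasurable k.continuous.stronglyMeasurable.aestronglyMeasurable
  have key : Tendsto (fun y => ∫ z, h z ∂(ν y : Measure E)) (𝓝 x) (𝓝 (h x)) := by
    refine tendsto_integral_of_bounded_pointwise_limit ν g h (C := 1)
      (fun n z => by rw [hg]; exact abs_semigroupAverage_le hC _ z) (fun z => ?_) x (fun n => ?_)
    · simp only [hg]
      exact tendsto_semigroupAverage hM.cadlag hF hC z tendsto_one_div_add_atTop_nhds_zero_nat
    · have h1 : Tendsto (fun y => ∫ z, g n z ∂(ν y : Measure E) - g n y) (𝓝 x) (𝓝 0) := by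
        refine squeeze_zero_norm (fun y => ?_)
          (by simpa only [mul_zero] using hlim.const_mul (2 * 1 / (b n : ℝ)))
        rw [hν]
        simp only [hg]
        exact abs_integral_semigroupAverage_sub_le hM hF hC (hρ y) (hρ1 y) (hb n) y
      simpa using h1.add ((g n).continuous.tendsto x)
  rw [hx] at key
  refine squeeze_zero (fun y => measureReal_nonneg) (fun y => ?_)
    (by simpa using key.const_sub 1)
  have hmeas : MeasurableSet {ω | r ≤ dist (M.X (ρ y ω) ω) x} :=
    measurableSet_le measurable_const ((hX y).dist measurable_const)
  have hi : Integrable (fun ω => h (M.X (ρ y ω) ω)) (M.P y) :=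
    .of_bound (h.continuous.measurable.comp (hX y)).aestronglyMeasurable 1
      (.of_forall fun ω => hC _)
  rw [hν, ← integral_indicator_one hmeas]
  calc _ ≤ ∫ ω, (1 - h (M.X (ρ y ω) ω)) ∂(M.P y) := by
        refine integral_mono ((integrable_const _).indicator hmeas) ((integrable_const _).sub hi)
          fun ω => ?_
        by_cases hω : r ≤ dist (M.X (ρ y ω) ω) x
        · simp [Set.indicator, hω, hfar _ hω]
        · simpa [Set.indicator, hω] using (abs_le.1 (hC (M.X (ρ y ω) ω))).2
    _ = _ := by rw [integral_sub (integrable_const _) hi]; simp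

/-- Near a point outside `O` the process leaves `O` quickly with high probability. -/
theorem tendsto_measure_lt_exitTime {O : Set E} (hA1 : M.StoppedFeller O) {x : E} (hx : x ∉ O)
    {σ : Ω → WithTop ℝ≥0} (hσ : IsStoppingTime M.𝓕 σ)
    (hσO : ∀ y, ∀ᵐ ω ∂(M.P y), M.exitTime O ω = σ ω) {δ : ℝ≥0} (hδ : 0 < δ) :
    Tendsto (fun y => (M.P y).real {ω | δ < σ ω}) (𝓝 x) (𝓝 0) := by
  obtain ⟨g, hg⟩ := hA1 δ hδ 1
  have hgσ : ∀ y, g y = (M.P y).real {ω | δ < σ ω} := fun y => by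
    have hmeas : MeasurableSet {ω | δ < σ ω} := M.𝓕.le δ _ (hσ.measurableSet_gt δ)
    rw [hg, stoppedSemigroup, ← integral_indicator_one hmeas]
    refine integral_congr_ae ?_
    filter_upwards [hσO y] with ω hω
    rw [hω]
    by_cases h : ω ∈ {ω | (δ : WithTop ℝ≥0) < σ ω}
    · rw [if_pos (show (δ : WithTop ℝ≥0) < σ ω from h), Set.indicator_of_mem h]
      rfl
    · rw [if_neg (show ¬ (δ : WithTop ℝ≥0) < σ ω from h), Set.indicator_of_notMem h]
  have hgx : g x = 0 := by
    rw [hg, stoppedSemigroup, integral_eq_zero_of_ae]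
    filter_upwards [M.start x] with ω hω
    have : M.exitTime O ω ≤ (0 : ℝ≥0) := hittingAfter_le_of_mem le_rfl (by simpa [hω] using hx)
    have : ¬ (δ : WithTop ℝ≥0) < M.exitTime O ω :=
      not_lt.2 (this.trans (WithTop.coe_le_coe.2 zero_le))
    exact if_neg this
  simp only [← hgσ]
  exact hgx ▸ g.continuous.tendsto x

/-- Started near a point `x` outside `O`, the process stopped at the exit time or earlier has, with
high probability and uniformly in the stopping rule, been stopped early and near `x`. -/
theorem eventually_forall_measure_not_near_le [BorelSpace E] [ProperSpace E] (hM : M.IsStandard)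
    (hF : M.IsWeakFeller) {O : Set E} (hA1 : M.StoppedFeller O) {x : E} (hx : x ∉ O)
    {σ : Ω → WithTop ℝ≥0} (hσ : IsStoppingTime M.𝓕 σ)
    (hσO : ∀ y, ∀ᵐ ω ∂(M.P y), M.exitTime O ω = σ ω) {δ : ℝ≥0} (hδ : 0 < δ) (hδ1 : δ ≤ 1) {r : ℝ}
    (hr : 0 < r) {ε : ℝ} (hε : 0 < ε) :
    ∀ᶠ y in 𝓝 x, ∀ τ : Ω → WithTop ℝ≥0, IsStoppingTime M.𝓕 τ → (M.P y).real
      {ω | min (τ ω) (σ ω) ≤ δ ∧ dist (M.at_ (fun ω => min (τ ω) (σ ω)) ω) x < r}ᶜ ≤ ε := by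
  have := M.isProbabilityMeasure
  set bad : (Ω → WithTop ℝ≥0) → Set Ω := fun τ =>
    {ω | min (τ ω) (σ ω) ≤ δ ∧ dist (M.at_ (fun ω => min (τ ω) (σ ω)) ω) x < r}ᶜ with hbad
  -- for each starting point, choose a stopping time that violates the bound, if there is one
  have hτ : ∀ y, ∃ τ : Ω → WithTop ℝ≥0, IsStoppingTime M.𝓕 τ ∧
      ((M.P y).real (bad τ) ≤ ε → ∀ τ', IsStoppingTime M.𝓕 τ' → (M.P y).real (bad τ') ≤ ε) := by
    intro y
    by_cases h : ∀ τ', IsStoppingTime M.𝓕 τ' → (M.P y).real (bad τ') ≤ ε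
    · exact ⟨σ, hσ, fun _ => h⟩
    · push Not at h
      obtain ⟨τ, hτ, h⟩ := h
      exact ⟨τ, hτ, fun h' => absurd h' h.not_ge⟩
  choose τ hτs hτε using hτ
  suffices Tendsto (fun y => (M.P y).real (bad (τ y))) (𝓝 x) (𝓝 0) from
    (this.eventually_le_const hε).mono hτε
  set ρ : E → Ω → ℝ≥0 := fun y ω => (min (min (τ y ω) (σ ω)) (1 : ℝ≥0)).untopD 0
  have hρc : ∀ y ω, (ρ y ω : WithTop ℝ≥0) = min (min (τ y ω) (σ ω)) (1 : ℝ≥0) := fun y ω =>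
    by
    obtain ⟨t, ht⟩ := WithTop.ne_top_iff_exists.1 (ne_top_of_le_ne_top WithTop.coe_ne_top
      (min_le_right (min (τ y ω) (σ ω)) ((1 : ℝ≥0) : WithTop ℝ≥0)))
    simp only [ρ, ← ht, WithTop.untopD_coe]
  have hρs : ∀ y, IsStoppingTime M.𝓕 fun ω => (ρ y ω : WithTop ℝ≥0) := fun y => by
    simp only [hρc]
    exact ((hτs y).min hσ).min_const 1
  have hρ1 : ∀ y ω, ρ y ω ≤ 1 := fun y ω => by
    rw [← WithTop.coe_le_coe, hρc]
    exact min_le_right _ _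
  have hlim : Tendsto (fun y => ∫ ω, (ρ y ω : ℝ) ∂(M.P y)) (𝓝 x) (𝓝 0) := by
    refine tendsto_order.2 ⟨fun a ha => .of_forall fun y =>
      ha.trans_le (integral_nonneg fun ω => (ρ y ω).coe_nonneg), fun a ha => ?_⟩
    -- `ρ y` is at most `a / 2` unless `a / 2 < σ`, and at most `1` always
    lift a to ℝ≥0 using ha.le
    have ha2 : 0 < a / 2 := half_pos (NNReal.coe_pos.1 ha)
    filter_upwards [(tendsto_measure_lt_exitTime hA1 hx hσ hσO ha2).eventually
      (gt_mem_nhds (NNReal.coe_pos.2 ha2))] with y hy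
    have hmeas : MeasurableSet {ω | ((a / 2 : ℝ≥0) : WithTop ℝ≥0) < σ ω} :=
      M.𝓕.le _ _ (hσ.measurableSet_gt _)
    have hi : Integrable ({ω | ((a / 2 : ℝ≥0) : WithTop ℝ≥0) < σ ω}.indicator (1 : Ω → ℝ))
        (M.P y) := (integrable_const _).indicator hmeas
    calc _ ≤ ∫ ω, (((a / 2 : ℝ≥0) : ℝ) +
          {ω | ((a / 2 : ℝ≥0) : WithTop ℝ≥0) < σ ω}.indicator (1 : Ω → ℝ) ω) ∂(M.P y) := by
          refine integral_mono_of_nonneg (.of_forall fun ω => (ρ y ω).coe_nonneg)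
            ((integrable_const _).add hi) (.of_forall fun ω => ?_)
          by_cases hω : ω ∈ {ω | ((a / 2 : ℝ≥0) : WithTop ℝ≥0) < σ ω}
          all_goals beta_reduce
          · rw [Set.indicator_of_mem hω]
            exact (NNReal.coe_le_coe.2 (hρ1 y ω)).trans (le_add_of_nonneg_left (a / 2).coe_nonneg)
          · rw [Set.indicator_of_notMem hω, add_zero]
            refine NNReal.coe_le_coe.2 (WithTop.coe_le_coe.1 ?_)
            rw [hρc]
            exact ((min_le_left _ _).trans (min_le_right _ _)).trans (not_lt.1 hω)
      _ < a := by
          rw [integral_add (integrable_const _) hi, integral_indicator_one hmeas]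
          simp only [integral_const, probReal_univ, one_smul]
          calc _ < ((a / 2 : ℝ≥0) : ℝ) + ((a / 2 : ℝ≥0) : ℝ) := by gcongr
            _ = a := by rw [← NNReal.coe_add, add_halves]
  have hfar := tendsto_measure_dist_ge hM hF x ρ hρs hρ1 hlim hr
  refine squeeze_zero (fun y => measureReal_nonneg) (fun y => ?_)
    (by simpa using (tendsto_measure_lt_exitTime hA1 hx hσ hσO hδ).add hfar)
  refine (measureReal_mono ?_).trans (measureReal_union_le _ _)
  intro ω hω
  by_contra hcon
  rw [Set.mem_union, not_or] at hcon
  have h1 : σ ω ≤ δ := not_lt.1 hcon.1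
  have h2 : dist (M.X (ρ y ω) ω) x < r := not_le.1 hcon.2
  refine hω ⟨(min_le_right _ _).trans h1, ?_⟩
  have : min (τ y ω) (σ ω) = ρ y ω := by
    rw [hρc, min_eq_left (b := ((1 : ℝ≥0) : WithTop ℝ≥0))]
    exact ((min_le_right _ _).trans h1).trans (WithTop.coe_le_coe.2 hδ1)
  rwa [at_, this, WithTop.untopD_coe]

end Convergence

end MarkovProcess

/-! ### Payoffs and the value function -/

/-- A function that is at most `c`, except on an event of probability at most `ε` where it is at
most `c + L`, has expectation at most `c + L ε`. -/
theorem integral_le_add_of_le_off {Ω : Type*} [MeasurableSpace Ω] {μ : Measure Ω}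
    [IsProbabilityMeasure μ] {Y : Ω → ℝ} (hY : Integrable Y μ) {B : Set Ω} (hB : MeasurableSet B)
    {c L ε : ℝ} (hL : 0 ≤ L) (hε : μ.real B ≤ ε) (hoff : ∀ᵐ ω ∂μ, ω ∉ B → Y ω ≤ c)
    (hle : ∀ ω, Y ω ≤ c + L) : ∫ ω, Y ω ∂μ ≤ c + L * ε := by
  have hi : Integrable (B.indicator fun _ => L) μ := (integrable_const L).indicator hB
  calc _ ≤ ∫ ω, (c + B.indicator (fun _ => L) ω) ∂μ := by
        refine integral_mono_ae hY ((integrable_const c).add hi) ?_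
        filter_upwards [hoff] with ω hω
        by_cases h : ω ∈ B
        · simpa [h] using hle ω
        · simpa [h] using hω h
    _ = c + L * μ.real B := by
        rw [integral_add (integrable_const c) hi, integral_indicator_const L hB]
        simp [mul_comm]
    _ ≤ _ := by gcongr

namespace MarkovProcess

section Payoff

variable {Ω E : Type*} [MeasurableSpace Ω] [MeasurableSpace E]
  (M : MarkovProcess Ω E)

/-- The times `u ≥ 0` before a (possibly infinite) time `t`. -/
def timesBefore (t : WithTop ℝ≥0) : Set ℝ :=
  {u : ℝ | 0 ≤ u ∧ (u.toNNReal : WithTop ℝ≥0) < t}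

open scoped Classical in
/-- The random payoff, of which `J` is the expectation, with an arbitrary random time `σ` in place
of the exit time. -/
noncomputable def payoff (α : ℝ) (f G H : ℝ≥0 × E → ℝ) (s : ℝ≥0) (τ σ : Ω → WithTop ℝ≥0) (ω : Ω) :
    ℝ :=
  (∫ u in timesBefore (min (τ ω) (σ ω)),
      Real.exp (-α * u) * f (s + u.toNNReal, M.X u.toNNReal ω))
    + (if τ ω < σ ω then M.discountedPayoff α G s τ ω else M.discountedPayoff α H s σ ω)

variable {M}

theorem measurableSet_timesBefore (t : WithTop ℝ≥0) : MeasurableSet (timesBefore t) :=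
  measurableSet_Ici.inter
    (measurableSet_Iio.preimage (WithTop.measurable_coe.comp measurable_real_toNNReal))

/-- In `J` the exit time may be replaced by an almost surely equal random time, such as a stopping
time, for which measurability is available. -/
theorem J_eq_integral_payoff {O : Set E} (α : ℝ) (f G H : ℝ≥0 × E → ℝ) (s : ℝ≥0) (y : E)
    (τ : Ω → WithTop ℝ≥0) {σ : Ω → WithTop ℝ≥0} (hσ : ∀ᵐ ω ∂(M.P y), M.exitTime O ω = σ ω) :
    M.J O α f G H s y τ = ∫ ω, M.payoff α f G H s τ σ ω ∂(M.P y) := by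
  refine integral_congr_ae ?_
  filter_upwards [hσ] with ω hω
  have hH : M.discountedPayoff α H s (M.exitTime O) ω = M.discountedPayoff α H s σ ω := by
    simp only [discountedPayoff, at_, hω]
  simp only [payoff, timesBefore, hH, hω]

variable [TopologicalSpace E] {α : ℝ} {f G H : (ℝ≥0 × E) →ᵇ ℝ} {s : ℝ≥0}

theorem abs_discountedPayoff_le (hα : 0 < α) (φ : (ℝ≥0 × E) →ᵇ ℝ) (s : ℝ≥0)
    (τ : Ω → WithTop ℝ≥0) (ω : Ω) : |M.discountedPayoff α φ s τ ω| ≤ ‖φ‖ := by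
  rw [discountedPayoff]
  split_ifs
  · simp
  · rw [abs_mul, Real.abs_exp, neg_mul]
    refine (mul_le_of_le_one_left (abs_nonneg _)
      (Real.exp_le_one_iff.2 (neg_nonpos.2 (by positivity)))).trans (φ.norm_coe_le_norm _)

theorem abs_running_le_of_min_le (hα : 0 < α) (ω : Ω) {t : WithTop ℝ≥0} {δ : ℝ≥0} (ht : t ≤ δ) :
    |∫ u in timesBefore t, Real.exp (-α * u) * f (s + u.toNNReal, M.X u.toNNReal ω)| ≤
      ‖f‖ * δ := by
  have hsub : timesBefore t ⊆ Set.Icc 0 (δ : ℝ) := fun u hu =>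
    ⟨hu.1, (Real.toNNReal_le_iff_le_coe).1 (WithTop.coe_le_coe.1 (hu.2.le.trans ht))⟩
  have hvol : volume (Set.Icc 0 (δ : ℝ)) < ⊤ := by simp
  rw [← Real.norm_eq_abs]
  refine (norm_setIntegral_le_of_norm_le_const (C := ‖f‖)
    ((measure_mono hsub).trans_lt hvol) fun u hu => ?_).trans ?_
  · rw [norm_mul, Real.norm_eq_abs, Real.abs_exp, neg_mul]
    exact (mul_le_of_le_one_left (norm_nonneg _)
      (Real.exp_le_one_iff.2 (neg_nonpos.2 (mul_nonneg hα.le hu.1)))).trans (f.norm_coe_le_norm _)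
  · gcongr
    calc volume.real (timesBefore t) ≤ volume.real (Set.Icc 0 (δ : ℝ)) :=
          measureReal_mono hsub hvol.ne
      _ = δ := by simp

theorem abs_running_le (hα : 0 < α) (ω : Ω) (t : WithTop ℝ≥0) :
    |∫ u in timesBefore t, Real.exp (-α * u) * f (s + u.toNNReal, M.X u.toNNReal ω)| ≤
      ‖f‖ / α := by
  have hint : IntegrableOn (fun u : ℝ => Real.exp (-α * u) * ‖f‖) (Set.Ici 0) :=
    ((integrableOn_Ici_iff_integrableOn_Ioi).2
      (integrableOn_exp_mul_Ioi (neg_neg_of_pos hα) 0)).mul_const _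
  have hsub : timesBefore t ⊆ Set.Ici 0 := fun u hu => hu.1
  rw [← Real.norm_eq_abs]
  refine (norm_integral_le_of_norm_le (hint.mono_set hsub) (.of_forall fun u => ?_)).trans ?_
  · rw [norm_mul, Real.norm_eq_abs, Real.abs_exp]
    gcongr
    exact f.norm_coe_le_norm _
  · refine (setIntegral_mono_set hint (.of_forall fun u => by positivity)
      hsub.eventuallyLE).trans_eq ?_
    rw [integral_Ici_eq_integral_Ioi, integral_mul_const,
      integral_exp_mul_Ioi (neg_neg_of_pos hα)]
    simp [field]

theorem abs_payoff_le (hα : 0 < α) (τ σ : Ω → WithTop ℝ≥0) (ω : Ω) :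
    |M.payoff α f G H s τ σ ω| ≤ ‖f‖ / α + (‖G‖ + ‖H‖) := by
  refine (abs_add_le _ _).trans (add_le_add (abs_running_le hα ω _) ?_)
  split_ifs
  · exact (abs_discountedPayoff_le hα G s τ ω).trans (le_add_of_nonneg_right (norm_nonneg _))
  · exact (abs_discountedPayoff_le hα H s σ ω).trans (le_add_of_nonneg_left (norm_nonneg _))

end Payoff

section Near

variable {Ω E : Type*} [MeasurableSpace Ω] [MetricSpace E] [MeasurableSpace E]
  {M : MarkovProcess Ω E} {α : ℝ} {f G H : (ℝ≥0 × E) →ᵇ ℝ} {s : ℝ≥0}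

theorem exists_abs_discountedPayoff_sub_lt (M : MarkovProcess Ω E) (α : ℝ) (φ : (ℝ≥0 × E) →ᵇ ℝ)
    (s : ℝ≥0) (x : E) {η : ℝ} (hη : 0 < η) :
    ∃ ε : ℝ, 0 < ε ∧ ∀ (τ : Ω → WithTop ℝ≥0) (ω : Ω) (t : ℝ≥0),
      τ ω = t → t < ε → dist (M.at_ τ ω) x < ε →
      |M.discountedPayoff α φ s τ ω - φ (s, x)| < η := by
  have hcont : Continuous fun p : ℝ≥0 × E => Real.exp (-α * p.1) * φ (s + p.1, p.2) := by fun_prop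
  obtain ⟨ε, hε, h⟩ := Metric.continuous_iff.1 hcont (0, x) η hη
  refine ⟨ε, hε, fun τ ω t ht htε hd => ?_⟩
  have := h (t, M.at_ τ ω) (by
    rw [Prod.dist_eq, max_lt_iff]
    exact ⟨by simpa [NNReal.dist_eq] using htε, hd⟩)
  rw [discountedPayoff, ht, if_neg WithTop.coe_ne_top, WithTop.untopD_coe]
  simpa [Real.dist_eq] using this

/-- If the process is stopped early and near `x`, the payoff is close to `G (s, x)` or to
`H (s, x)`, depending on whether it was stopped before `σ`. -/
theorem exists_payoff_near (M : MarkovProcess Ω E) (hα : 0 < α) (f G H : (ℝ≥0 × E) →ᵇ ℝ)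
    (s : ℝ≥0) (x : E) {η : ℝ} (hη : 0 < η) :
    ∃ δ : ℝ≥0, 0 < δ ∧ δ ≤ 1 ∧ ∃ r : ℝ, 0 < r ∧ ∀ (τ σ : Ω → WithTop ℝ≥0) (ω : Ω),
      min (τ ω) (σ ω) ≤ δ → dist (M.at_ (fun ω => min (τ ω) (σ ω)) ω) x < r →
      (τ ω < σ ω → |M.payoff α f G H s τ σ ω - G (s, x)| ≤ η) ∧
      (σ ω ≤ τ ω → |M.payoff α f G H s τ σ ω - H (s, x)| ≤ η) := by
  obtain ⟨ε₁, hε₁, hG⟩ := exists_abs_discountedPayoff_sub_lt M α G s x (half_pos hη)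
  obtain ⟨ε₂, hε₂, hH⟩ := exists_abs_discountedPayoff_sub_lt M α H s x (half_pos hη)
  have hε : 0 < min ε₁ ε₂ := lt_min hε₁ hε₂
  have hf : 0 < η / 2 / (‖f‖ + 1) := by positivity
  obtain ⟨δ, hδ, hδlt⟩ := exists_between (lt_min (lt_min hε hf) one_pos)
  lift δ to ℝ≥0 using hδ.le
  have hδε : (δ : ℝ) < min ε₁ ε₂ := hδlt.trans_le ((min_le_left _ _).trans (min_le_left _ _))
  have hδf : ‖f‖ * δ ≤ η / 2 := by
    have h1 : (δ : ℝ) ≤ η / 2 / (‖f‖ + 1) :=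
      hδlt.le.trans ((min_le_left _ _).trans (min_le_right _ _))
    rw [le_div_iff₀ (by positivity)] at h1
    nlinarith [δ.coe_nonneg]
  refine ⟨δ, NNReal.coe_pos.1 hδ, NNReal.coe_le_coe.1 (hδlt.le.trans (min_le_right _ _)),
    min ε₁ ε₂, hε, fun τ σ ω ht hd => ?_⟩
  have hrun := abs_running_le_of_min_le (M := M) (f := f) (s := s) hα ω ht
  have hsum : ∀ {a b c : ℝ}, |a| ≤ ‖f‖ * δ → |b - c| < η / 2 → |a + b - c| ≤ η := by
    intro a b c ha hb
    rw [add_sub_assoc]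
    exact (abs_add_le _ _).trans (by linarith)
  have htime : ∀ t : ℝ≥0, (t : WithTop ℝ≥0) ≤ δ → (t : ℝ) < min ε₁ ε₂ := fun t ht' =>
    (NNReal.coe_le_coe.2 (WithTop.coe_le_coe.1 ht')).trans_lt hδε
  constructor
  · intro hlt
    rw [payoff, if_pos hlt]
    rw [min_eq_left hlt.le] at ht
    obtain ⟨t, ht'⟩ := WithTop.ne_top_iff_exists.1 (ne_top_of_le_ne_top WithTop.coe_ne_top ht)
    refine hsum hrun (hG τ ω t ht'.symm ((htime t (ht' ▸ ht)).trans_le (min_le_left _ _)) ?_)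
    rw [at_, min_eq_left hlt.le] at hd
    exact hd.trans_le (min_le_left _ _)
  · intro hle
    rw [payoff, if_neg hle.not_gt]
    rw [min_eq_right hle] at ht
    obtain ⟨t, ht'⟩ := WithTop.ne_top_iff_exists.1 (ne_top_of_le_ne_top WithTop.coe_ne_top ht)
    refine hsum hrun (hH σ ω t ht'.symm ((htime t (ht' ▸ ht)).trans_le (min_le_right _ _)) ?_)
    rw [at_, min_eq_right hle] at hd
    exact hd.trans_le (min_le_right _ _)

theorem measurable_discountedPayoff [BorelSpace E] [SecondCountableTopology E] (hc : M.IsCadlag)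
    (α : ℝ) (φ : (ℝ≥0 × E) →ᵇ ℝ) (s : ℝ≥0) {τ : Ω → WithTop ℝ≥0} (hτ : Measurable τ) :
    Measurable (M.discountedPayoff α φ s τ) := by
  have hu : Measurable fun ω => (τ ω).untopD 0 := hτ.untopD 0
  refine Measurable.ite ((measurableSet_singleton _).preimage hτ) measurable_const ?_
  exact (Real.measurable_exp.comp (hu.coe_nnreal_real.const_mul _)).mul
    (φ.continuous.measurable.comp ((hu.const_add s).prodMk (measurable_at hc hτ)))

theorem stronglyMeasurable_payoff [BorelSpace E] [SecondCountableTopology E] (hc : M.IsCadlag)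
    (α : ℝ) (f G H : (ℝ≥0 × E) →ᵇ ℝ) (s : ℝ≥0) {τ σ : Ω → WithTop ℝ≥0} (hτ : Measurable τ)
    (hσ : Measurable σ) : StronglyMeasurable (M.payoff α f G H s τ σ) := by
  refine StronglyMeasurable.add ?_ (Measurable.ite (measurableSet_lt hτ hσ)
    (measurable_discountedPayoff hc α G s hτ)
    (measurable_discountedPayoff hc α H s hσ)).stronglyMeasurable
  have htime : Measurable fun p : Ω × ℝ => p.2.toNNReal :=
    measurable_real_toNNReal.comp measurable_snd
  have hset : MeasurableSet {p : Ω × ℝ | p.2 ∈ timesBefore (min (τ p.1) (σ p.1))} :=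
    (measurableSet_Ici.preimage measurable_snd).inter (measurableSet_lt
      (WithTop.measurable_coe.comp htime) ((hτ.min hσ).comp measurable_fst))
  have hfun : Measurable fun p : Ω × ℝ =>
      Real.exp (-α * p.2) * f (s + p.2.toNNReal, M.X p.2.toNNReal p.1) :=
    (Real.measurable_exp.comp (measurable_snd.const_mul _)).mul
      (f.continuous.measurable.comp ((htime.const_add s).prodMk
        ((measurable_uncurry_X hc).comp (htime.prodMk measurable_fst))))
  have := (hfun.indicator hset).stronglyMeasurable.integral_prod_right' (ν := volume)
  convert this using 2 with ω
  rw [← integral_indicator (measurableSet_timesBefore _)]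
  rfl

end Near

section Value

variable {Ω E : Type*} [MeasurableSpace Ω] [MetricSpace E] [MeasurableSpace E]
  {M : MarkovProcess Ω E}

/-- At the exit time the process is, by right-continuity, in the closed complement of `O`. -/
theorem ae_pos_exitTime (hM : M.IsStandard) {O : Set E} (hO : IsOpen O) {y : E} (hy : y ∈ O) :
    ∀ᵐ ω ∂(M.P y), 0 < M.exitTime O ω := by
  filter_upwards [M.start y] with ω hω
  refine pos_iff_ne_zero.2 fun h0 => ?_
  have hmem := M.at_hittingAfter_mem_closure hM.cadlag Oᶜ (ω := ω)
    (show M.exitTime O ω < ⊤ from h0 ▸ WithTop.coe_lt_top 0)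
  rw [hO.isClosed_compl.closure_eq, at_, show hittingAfter M.X Oᶜ 0 ω = 0 from h0] at hmem
  exact hmem (show M.X 0 ω ∈ O from hω ▸ hy)

end Value

end MarkovProcess

theorem mainTheorem3 {Ω E : Type*} [MeasurableSpace Ω] [MetricSpace E] [ProperSpace E]
    [MeasurableSpace E] [BorelSpace E]
    (M : MarkovProcess Ω E) (hM : M.IsStandard) (hFeller : M.IsWeakFeller)
    (O : Set E) (hO : IsOpen O) (hA1 : M.StoppedFeller O)
    (α : ℝ) (hα : 0 < α) (f G H : (ℝ≥0 × E) →ᵇ ℝ) (s : ℝ≥0) (x : E) (hx : x ∈ frontier O) :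
    Tendsto (fun y => M.value O α f G H s y) (𝓝[O] x) (𝓝 (max (G (s, x)) (H (s, x)))) := by
  have := M.isProbabilityMeasure
  have hxO : x ∉ O := by
    rw [hO.frontier_eq] at hx
    exact hx.2
  obtain ⟨σ, hσ, hσO⟩ := M.exists_isStoppingTime_ae_eq_exitTime hM hO
  set K : ℝ := ‖f‖ / α + (‖G‖ + ‖H‖) with hK
  have hK0 : 0 ≤ K := by positivity
  have hfK : 0 ≤ ‖f‖ / α := by positivity
  have hGK : |G (s, x)| ≤ K := by
    have : |G (s, x)| ≤ ‖G‖ := G.norm_coe_le_norm _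
    linarith [norm_nonneg H]
  have hHK : |H (s, x)| ≤ K := by
    have : |H (s, x)| ≤ ‖H‖ := H.norm_coe_le_norm _
    linarith [norm_nonneg G]
  set Y : (Ω → WithTop ℝ≥0) → Ω → ℝ := fun τ => M.payoff α f G H s τ σ with hYdef
  have hYK : ∀ τ ω, |Y τ ω| ≤ K := fun τ ω => MarkovProcess.abs_payoff_le hα τ σ ω
  have hJ : ∀ τ y, M.J O α f G H s y τ = ∫ ω, Y τ ω ∂(M.P y) := fun τ y =>
    MarkovProcess.J_eq_integral_payoff α f G H s y τ (hσO y)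
  have hYi : ∀ {τ}, IsStoppingTime M.𝓕 τ → ∀ y, Integrable (Y τ) (M.P y) := fun hτ y =>
    .of_bound (MarkovProcess.stronglyMeasurable_payoff hM.cadlag α f G H s hτ.measurable'
      hσ.measurable').aestronglyMeasurable K (.of_forall fun ω => hYK _ ω)
  have hbdd : ∀ y, BddAbove (Set.range fun τ : {τ : Ω → WithTop ℝ≥0 // IsStoppingTime M.𝓕 τ} =>
      M.J O α f G H s y τ) := by
    rintro y
    refine ⟨K, ?_⟩
    rintro _ ⟨τ, rfl⟩
    simp only [hJ]
    refine (le_abs_self _).trans ?_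
    simpa using norm_integral_le_of_norm_le_const (μ := M.P y) (f := Y τ) (.of_forall fun ω => hYK τ ω)
  have htop : IsStoppingTime M.𝓕 fun _ => (⊤ : WithTop ℝ≥0) := fun i => by simp
  have hzero : IsStoppingTime M.𝓕 fun _ => ((0 : ℝ≥0) : WithTop ℝ≥0) := isStoppingTime_const _ 0
  rw [Metric.tendsto_nhds]
  intro e he
  set η : ℝ := e / 4 with hη
  have hη0 : 0 < η := by positivity
  obtain ⟨δ, hδ, hδ1, r, hr, hnear⟩ := MarkovProcess.exists_payoff_near M hα f G H s x hη0
  -- off the good event the payoff exceeds the target by at most `2 * K + η`, so a bad event of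
  -- probability `η / (2 * K + η + 1)` costs at most `η`
  have hε : 0 < η / (2 * K + η + 1) := by positivity
  have hεL : (2 * K + η) * (η / (2 * K + η + 1)) ≤ η := by
    rw [mul_div_assoc', div_le_iff₀ (by positivity)]
    nlinarith
  filter_upwards [(MarkovProcess.eventually_forall_measure_not_near_le hM hFeller hA1 hxO hσ hσO hδ
    hδ1 hr hε).filter_mono nhdsWithin_le_nhds, self_mem_nhdsWithin] with y hy hyO
  set good : (Ω → WithTop ℝ≥0) → Set Ω := fun τ =>
    {ω | min (τ ω) (σ ω) ≤ δ ∧ dist (M.at_ (fun ω => min (τ ω) (σ ω)) ω) x < r} with hgood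
  have hgoodm : ∀ {τ}, IsStoppingTime M.𝓕 τ → MeasurableSet (good τ)ᶜ := fun {τ} hτ => by
    have hm : Measurable fun ω => min (τ ω) (σ ω) := hτ.measurable'.min hσ.measurable'
    exact ((measurableSet_le hm measurable_const).inter (measurableSet_lt
      ((MarkovProcess.measurable_at hM.cadlag hm).dist measurable_const) measurable_const)).compl
  -- one-sided estimates of the expected payoff from its values on the good event
  have hupper : ∀ {τ} (c : ℝ), IsStoppingTime M.𝓕 τ → -K ≤ c → (∀ ω ∈ good τ, Y τ ω ≤ c + η) →
      M.J O α f G H s y τ ≤ c + 2 * η := fun {τ} c hτ hc h => by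
    rw [hJ]
    have := integral_le_add_of_le_off (hYi hτ y) (hgoodm hτ) (c := c + η) (L := 2 * K + η)
      (by positivity) (hy τ hτ) (.of_forall fun ω hω => h ω (not_not.1 hω))
      (fun ω => by linarith [(abs_le.1 (hYK τ ω)).2])
    linarith
  have hlower : ∀ {τ} (c : ℝ), IsStoppingTime M.𝓕 τ → |c| ≤ K →
      (∀ᵐ ω ∂(M.P y), ω ∈ good τ → |Y τ ω - c| ≤ η) →
      c - 2 * η ≤ M.value O α f G H s y := fun {τ} c hτ hc h => by
    refine le_trans ?_ (le_ciSup (hbdd y) ⟨τ, hτ⟩)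
    rw [hJ]
    have := integral_le_add_of_le_off (hYi hτ y).neg (hgoodm hτ) (c := -c + η) (L := 2 * K + η)
      (by positivity) (hy τ hτ)
      (h.mono fun ω h' hω => by
        have := (abs_le.1 (h' (not_not.1 hω))).1
        simp only [Pi.neg_apply]
        linarith)
      (fun ω => by
        simp only [Pi.neg_apply]
        linarith [(abs_le.1 (hYK τ ω)).1, (abs_le.1 hc).2])
    simp only [Pi.neg_apply, integral_neg] at this
    linarith
  have h1 : M.value O α f G H s y ≤ max (G (s, x)) (H (s, x)) + 2 * η := by
    have : Nonempty {τ : Ω → WithTop ℝ≥0 // IsStoppingTime M.𝓕 τ} := ⟨⟨_, htop⟩⟩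
    refine ciSup_le fun τ => hupper _ τ.2 ((abs_le.1 hGK).1.trans (le_max_left _ _)) fun ω hω => ?_
    rcases lt_or_ge (τ.1 ω) (σ ω) with hlt | hle
    · have := (abs_le.1 ((hnear τ σ ω hω.1 hω.2).1 hlt)).2
      linarith [le_max_left (G (s, x)) (H (s, x))]
    · have := (abs_le.1 ((hnear τ σ ω hω.1 hω.2).2 hle)).2
      linarith [le_max_right (G (s, x)) (H (s, x))]
  -- stopping at once
  have h2 : G (s, x) - 2 * η ≤ M.value O α f G H s y := by
    refine hlower _ hzero hGK ?_
    filter_upwards [MarkovProcess.ae_pos_exitTime hM hO hyO, hσO y] with ω hpos hω hg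
    exact (hnear _ σ ω hg.1 hg.2).1 (hω ▸ hpos)
  -- never stopping before the exit
  have h3 : H (s, x) - 2 * η ≤ M.value O α f G H s y :=
    hlower _ htop hHK (.of_forall fun ω hg => (hnear _ σ ω hg.1 hg.2).2 le_top)
  have h4 : max (G (s, x)) (H (s, x)) ≤ M.value O α f G H s y + 2 * η :=
    max_le (by linarith) (by linarith)
  rw [Real.dist_eq, abs_lt]
  constructor <;> linarith
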